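/- Let $L_N[u]$ $(N\ge 0)$ be the differential polynomials in $u=u(z)$ determined by the Lenard recursion $\frac{d}{dz}L_{N+1}[u]=\left(\frac{d^3}{dz^3}+4u\frac{d}{dz}+2u_z\right)L_N[u]$, $L_0[u]=\tfrac12$, with zero integration constants (that is, $L_N[u]$ has no constant term for $N\ge1$). For $N\ge1$ and $\alpha\in\mathbb C$, the $N$-th equation of the second Painlevé hierarchy is $$\left(\frac{d}{dz}+2w\right)L_N[w'-w^2]-zw-\alpha=0 .$$ Fix $N\ge 1$ and let $Q_0^{(N)},Q_1^{(N)},Q_2^{(N)},\dots\in\mathbb C[z]$ be the associated Yablonskii–Vorob'ev polynomials: monic polynomials with $Q_0^{(N)}=1$ such that for every $n\ge1$ the rational function $$w^{(N)}(z;n)=\frac{d}{dz}\ln\frac{Q_{n-1}^{(N)}(z)}{Q_n^{(N)}(z)}$$ is a solution of the $N$-th equation with $\alpha=n$. Then for every $n\ge0$ $$\deg Q_n^{(N)}=\sum_{i=1}^n i=\frac{n(n+1)}2 .$$ -/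

import Mathlib

open MvPolynomial in
/-- The total derivative `d_z` on differential polynomials in one unknown `u`:
the variable `X k` stands for the `k`-th derivative of `u`, so `d_z (X k) = X (k + 1)`. -/
noncomputable def totalDeriv : Derivation ℚ (MvPolynomial ℕ ℚ) (MvPolynomial ℕ ℚ) :=
  mkDerivation ℚ fun k => X (k + 1)

open MvPolynomial in
/-- `L : ℕ → ℚ[u, u_z, u_zz, …]` is the sequence of Lenard differential polynomials:
`L₀ = 1/2`, `d_z L_{N+1} = (d_z³ + 4 u d_z + 2 u_z) L_N`, and no integration constants are added
(`L_{N+1}` has no constant term). -/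
structure IsLenardSequence (L : ℕ → MvPolynomial ℕ ℚ) : Prop where
  zero : L 0 = C (1 / 2)
  recursion : ∀ N, totalDeriv (L (N + 1)) =
    totalDeriv (totalDeriv (totalDeriv (L N))) + 4 * X 0 * totalDeriv (L N) + 2 * X 1 * L N
  constant_term : ∀ N, constantCoeff (L (N + 1)) = 0

open MvPolynomial in
/-- An explicit form of the Lenard differential polynomials `L_N[u]`. That this is the sequence
defined by the Lenard recursion is proved in `isLenardSequence_lenard` and
`IsLenardSequence.eq_lenard`. -/
noncomputable def lenard : ℕ → MvPolynomial ℕ ℚ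
  | 0 => C (1 / 2)
  | n + 1 =>
    (∑ i : Fin (n + 1), (2 * (lenard i * totalDeriv (totalDeriv (lenard (n - i))))
      - totalDeriv (lenard i) * totalDeriv (lenard (n - i))
      + 4 * X 0 * (lenard i * lenard (n - i))))
    - ∑ i : Fin n, lenard (i + 1) * lenard (n - i)

namespace LenardAux

open MvPolynomial Finset

theorem two_mul_lenard_zero : 2 * lenard 0 = 1 := by
  have h : (2 : MvPolynomial ℕ ℚ) = C 2 := (map_ofNat C 2).symm
  rw [lenard, h, ← C_mul]
  norm_num

theorem deriv_lenard_zero : totalDeriv (lenard 0) = 0 := by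
  rw [lenard]
  exact derivation_C _ _

theorem bilinear (n : ℕ) :
    ∑ p ∈ antidiagonal (n + 1), lenard p.1 * lenard p.2 =
      ∑ p ∈ antidiagonal n, (2 * (lenard p.1 * totalDeriv (totalDeriv (lenard p.2)))
        - totalDeriv (lenard p.1) * totalDeriv (lenard p.2)
        + 4 * X 0 * (lenard p.1 * lenard p.2)) := by
  have hrec : lenard (n + 1) =
      (∑ p ∈ antidiagonal n, (2 * (lenard p.1 * totalDeriv (totalDeriv (lenard p.2)))
        - totalDeriv (lenard p.1) * totalDeriv (lenard p.2)
        + 4 * X 0 * (lenard p.1 * lenard p.2)))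
      - ∑ i ∈ range n, lenard (i + 1) * lenard (n - i) := by
    rw [lenard, Finset.Nat.sum_antidiagonal_eq_sum_range_succ_mk,
      ← Fin.sum_univ_eq_sum_range, ← Fin.sum_univ_eq_sum_range]
  have hL : ∑ p ∈ antidiagonal (n + 1), lenard p.1 * lenard p.2 =
      2 * lenard 0 * lenard (n + 1) + ∑ i ∈ range n, lenard (i + 1) * lenard (n - i) := by
    rw [Finset.Nat.sum_antidiagonal_eq_sum_range_succ_mk, Finset.sum_range_succ,
      Finset.sum_range_succ']
    have : ∀ i ∈ range n, lenard (i + 1) * lenard (n + 1 - (i + 1)) =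
        lenard (i + 1) * lenard (n - i) := by
      intro i _
      rw [Nat.add_sub_add_right]
    rw [Finset.sum_congr rfl this]
    simp only [Nat.sub_zero, Nat.sub_self]
    ring
  rw [hL, two_mul_lenard_zero, one_mul, hrec]
  ring

theorem convolution (n : ℕ) :
    ∑ p ∈ antidiagonal n, lenard p.1 *
      (totalDeriv (totalDeriv (totalDeriv (lenard p.2))) + 4 * X 0 * totalDeriv (lenard p.2)
        + 2 * X 1 * lenard p.2 - totalDeriv (lenard (p.2 + 1))) = 0 := by
  have h := congrArg totalDeriv (bilinear n)
  have h4 : totalDeriv (4 * X 0) = 4 * X 1 := by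
    have : (4 : MvPolynomial ℕ ℚ) = C 4 := (map_ofNat C 4).symm
    rw [this, ← smul_eq_C_mul, Derivation.map_smul, totalDeriv, mkDerivation_X, smul_eq_C_mul]
  have h2 : ∀ f, totalDeriv (2 * f) = 2 * totalDeriv f := by
    intro f
    rw [two_mul, map_add, two_mul]
  simp only [map_sum, map_add, map_sub, Derivation.leibniz, h2, h4, smul_eq_mul] at h
  have s1 : ∑ p ∈ antidiagonal (n + 1),
      (lenard p.1 * totalDeriv (lenard p.2) + lenard p.2 * totalDeriv (lenard p.1)) =
      2 * ∑ p ∈ antidiagonal n, lenard p.1 * totalDeriv (lenard (p.2 + 1)) := by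
    rw [Finset.sum_add_distrib]
    have := Finset.Nat.sum_antidiagonal_swap (n := n + 1)
      (f := fun p => lenard p.1 * totalDeriv (lenard p.2))
    simp only [Prod.fst_swap, Prod.snd_swap] at this
    rw [this, Finset.Nat.sum_antidiagonal_succ', deriv_lenard_zero]
    ring
  rw [s1] at h
  have sw := Finset.Nat.sum_antidiagonal_swap (n := n)
      (f := fun p => totalDeriv (lenard p.1) * totalDeriv (totalDeriv (lenard p.2)))
  have sw2 := Finset.Nat.sum_antidiagonal_swap (n := n)
      (f := fun p => X 0 * (lenard p.1 * totalDeriv (lenard p.2)))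
  simp only [Prod.fst_swap, Prod.snd_swap] at sw sw2
  have key : 2 * ∑ p ∈ antidiagonal n, lenard p.1 *
      (totalDeriv (totalDeriv (totalDeriv (lenard p.2))) + 4 * X 0 * totalDeriv (lenard p.2)
        + 2 * X 1 * lenard p.2 - totalDeriv (lenard (p.2 + 1))) = 0 := by
    rw [← sub_eq_zero] at h sw sw2
    rw [Finset.mul_sum] at h ⊢
    rw [← Finset.sum_sub_distrib] at h sw sw2
    have e : ∀ a b c d : MvPolynomial ℕ ℚ, a = 0 → b = 0 → c = 0 →
        d = -a + b - 4 * c → d = 0 := by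
      intro a b c d ha hb hc hd
      rw [hd, ha, hb, hc]; ring
    refine e _ _ _ _ h sw sw2 ?_
    rw [Finset.mul_sum, ← Finset.sum_neg_distrib, ← Finset.sum_add_distrib,
      ← Finset.sum_sub_distrib]
    refine Finset.sum_congr rfl fun p _ => ?_
    ring
  exact (mul_eq_zero.mp key).resolve_left two_ne_zero

theorem constantCoeff_totalDeriv (f : MvPolynomial ℕ ℚ) :
    constantCoeff (totalDeriv f) = 0 := by
  induction f using MvPolynomial.induction_on with
  | C a => rw [derivation_C, map_zero]
  | add p q hp hq => rw [map_add, map_add, hp, hq, add_zero]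
  | mul_X p i hp =>
    rw [Derivation.leibniz, totalDeriv, mkDerivation_X, ← totalDeriv]
    simp

theorem constantCoeff_lenard_succ (n : ℕ) : constantCoeff (lenard (n + 1)) = 0 := by
  induction n using Nat.strong_induction_on with
  | _ n ih =>
    rw [lenard]
    simp only [map_sub, map_sum, map_add, map_mul, constantCoeff_totalDeriv, constantCoeff_X]
    rw [Finset.sum_eq_zero, Finset.sum_eq_zero, sub_zero]
    · intro i _
      rw [ih i i.2, zero_mul]
    · intro i _
      ring

theorem pderiv_totalDeriv (m : ℕ) (f : MvPolynomial ℕ ℚ) :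
    pderiv (m + 1) (totalDeriv f) = totalDeriv (pderiv (m + 1) f) + pderiv m f := by
  induction f using MvPolynomial.induction_on with
  | C a => simp [derivation_C]
  | add p q hp hq => simp only [map_add, hp, hq]; ring
  | mul_X p i hp =>
    have hX : ∀ k, totalDeriv (X k) = X (k + 1) := fun k => by rw [totalDeriv, mkDerivation_X]
    have h1 : ∀ k j, totalDeriv (pderiv k (X j)) = 0 := by
      intro k j
      by_cases h : j = k
      · subst h; rw [pderiv_X_self, Derivation.map_one_eq_zero]
      · rw [pderiv_X_of_ne h, map_zero]
    have h2 : pderiv (m + 1) (X (i + 1) : MvPolynomial ℕ ℚ) = pderiv m (X i) := by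
      by_cases h : i = m
      · subst h; rw [pderiv_X_self, pderiv_X_self]
      · rw [pderiv_X_of_ne h, pderiv_X_of_ne (by omega)]
    simp only [Derivation.leibniz, map_add, smul_eq_mul, hX, hp, h1, h2]
    ring

theorem eq_C_of_totalDeriv_eq_zero {f : MvPolynomial ℕ ℚ} (hf : totalDeriv f = 0) :
    f = C (constantCoeff f) := by
  have step : ∀ m, pderiv (m + 1) f = 0 → pderiv m f = 0 := by
    intro m hm
    have := pderiv_totalDeriv m f
    rwa [hf, hm, map_zero, map_zero, zero_add, eq_comm] at this
  obtain ⟨B, hB⟩ : ∃ B, ∀ m ∈ f.vars, m < B := ⟨f.vars.sup id + 1, fun m hm =>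
    Nat.lt_succ_of_le (Finset.le_sup (f := id) hm)⟩
  have hall : ∀ m, pderiv m f = 0 := by
    have hge : ∀ m, B ≤ m → pderiv m f = 0 := fun m hm =>
      pderiv_eq_zero_of_notMem_vars fun h => absurd (hB m h) (by omega)
    have hdown : ∀ k m, B ≤ m + k → pderiv m f = 0 := by
      intro k
      induction k with
      | zero => exact fun m hm => hge m hm
      | succ k ih => exact fun m hm => step m (ih (m + 1) (by omega))
    exact fun m => hdown B m (by omega)
  ext s
  rw [coeff_C]
  split_ifs with h
  · rw [← h, constantCoeff_eq]
  · obtain ⟨i, hi⟩ : ∃ i, s i ≠ 0 := by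
      by_contra hc
      push Not at hc
      exact h (Finsupp.ext fun i => (hc i).symm)
    have := coeff_pderiv f (s - Finsupp.single i 1) (i := i)
    have hs : s - Finsupp.single i 1 + Finsupp.single i 1 = s := by
      ext j
      by_cases hj : j = i
      · subst hj; simp; omega
      · simp [Ne.symm hj]
    rw [hall i, hs, coeff_zero, eq_comm] at this
    refine (mul_eq_zero.mp this).resolve_right ?_
    positivity

end LenardAux

open MvPolynomial Finset LenardAux in
theorem isLenardSequence_lenard : IsLenardSequence lenard where
  zero := by rw [lenard]
  recursion := by
    intro n
    induction n using Nat.strong_induction_on with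
    | _ n ih =>
      have h := convolution n
      rw [Finset.sum_eq_single (0, n)] at h
      · have h0 : lenard 0 ≠ 0 := by
          intro h0
          have := two_mul_lenard_zero
          rw [h0, mul_zero] at this
          exact zero_ne_one this
        exact (sub_eq_zero.mp ((mul_eq_zero.mp h).resolve_left h0)).symm
      · rintro ⟨i, j⟩ hp hne
        rw [HasAntidiagonal.mem_antidiagonal] at hp
        have hj : j < n := by
          rcases Nat.eq_zero_or_pos i with hi | hi
          · exact absurd (by ext <;> simp at hp ⊢ <;> omega) hne
          · simp at hp; omega
        simp only
        rw [ih j hj, sub_self, mul_zero]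
      · intro hn
        exact absurd (by simp) hn
  constant_term := constantCoeff_lenard_succ

open MvPolynomial LenardAux in
theorem IsLenardSequence.eq_lenard {L : ℕ → MvPolynomial ℕ ℚ} (hL : IsLenardSequence L) :
    L = lenard := by
  funext n
  induction n with
  | zero => rw [hL.zero, isLenardSequence_lenard.zero]
  | succ n ih =>
    have h : totalDeriv (L (n + 1) - lenard (n + 1)) = 0 := by
      rw [map_sub, hL.recursion, isLenardSequence_lenard.recursion, ih, sub_self]
    have := eq_C_of_totalDeriv_eq_zero h
    rw [map_sub, hL.constant_term, isLenardSequence_lenard.constant_term, sub_zero, C_0] at this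
    exact sub_eq_zero.mp this

/-- The value at `z` of the differential polynomial `L_N[u]`, for a function `u` of `z`. -/
noncomputable def lenardEval (N : ℕ) (u : ℂ → ℂ) (z : ℂ) : ℂ :=
  MvPolynomial.aeval (fun k => iteratedDeriv k u z) (lenard N)

/-- The left-hand side of the `N`-th equation of the second Painlevé hierarchy,
`P₂^(N)[w, α] = (d/dz + 2w) L_N[w' - w²] - z w - α`, at the point `z`. -/
noncomputable def painleveII (N : ℕ) (α : ℂ) (w : ℂ → ℂ) (z : ℂ) : ℂ :=
  deriv (lenardEval N fun x => deriv w x - w x ^ 2) z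
    + 2 * w z * lenardEval N (fun x => deriv w x - w x ^ 2) z - z * w z - α

open Polynomial in
/-- `w` is a rational function of `z` which solves `P₂^(N)[w, α] = 0`. The values of `w` at the
finitely many zeros of the denominator `q` play no role. -/
def IsRationalSolution (N : ℕ) (α : ℂ) (w : ℂ → ℂ) : Prop :=
  ∃ p q : ℂ[X], q ≠ 0 ∧
    ∀ z, q.eval z ≠ 0 → w z = p.eval z / q.eval z ∧ painleveII N α w z = 0

open Polynomial in
/-- `Q 0, Q 1, Q 2, …` are the polynomials `Q_n^(N)` attached to the rational solutions of the
`N`-th equation of the second Painlevé hierarchy: they are monic, `Q 0 = 1`, and for each `n ≥ 1`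
the function `w(z; n) = d/dz ln (Q_{n-1}(z) / Q_n(z))` is the rational solution with `α = n`. -/
structure IsYablonskiiVorobevFamily (N : ℕ) (Q : ℕ → ℂ[X]) : Prop where
  zero : Q 0 = 1
  monic : ∀ n, (Q n).Monic
  solution : ∀ n : ℕ, 1 ≤ n →
    IsRationalSolution N n (logDeriv fun z => (Q (n - 1)).eval z / (Q n).eval z)

/-!
Being the logarithmic derivative of a rational function, `w` is holomorphic at `∞` and vanishes
there, so every differential polynomial in `w` is holomorphic at `∞`, in particular `L_N[w' - w²]`.
Its derivative vanishes at `∞`, and so does `w L_N[w' - w²]`. Letting `z → ∞` in the `N`-th equation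
with `α = n` therefore leaves `lim z w(z) = -n`. But `z w(z) → deg Q_{n-1} - deg Q_n`, so the degree
grows by `n` at step `n`.
-/

section Cobounded

open Bornology Filter Polynomial Topology

theorem tendsto_deriv_cobounded {E : Type*} [NormedAddCommGroup E] [NormedSpace ℂ E] {f : ℂ → E}
    (hf : ∀ᶠ z in cobounded ℂ, DifferentiableAt ℂ f z) (hb : f =O[cobounded ℂ] (1 : ℂ → ℂ)) :
    Tendsto (deriv f) (cobounded ℂ) (𝓝 0) := by
  obtain ⟨C, hC⟩ := hb.bound
  obtain ⟨R, -, hR⟩ := hasBasis_cobounded_norm.eventually_iff.mp (hf.and hC)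
  have hball (z : ℂ) (hz : 2 * R ≤ ‖z‖) : ∀ x ∈ Metric.closedBall z (‖z‖ / 2), R ≤ ‖x‖ := by
    intro x hx
    have := norm_sub_norm_le z x
    rw [mem_closedBall_iff_norm'] at hx
    linarith
  have hcauchy : ∀ᶠ z in cobounded ℂ, ‖deriv f z‖ ≤ C / (‖z‖ / 2) := by
    filter_upwards [eventually_cobounded_le_norm (2 * R), eventually_cobounded_le_norm 1]
      with z hz hz1
    refine Complex.norm_deriv_le_of_forall_mem_sphere_norm_le (by linarith) ?_ fun x hx => ?_
    · refine DifferentiableOn.diffContOnCl_ball (U := Metric.closedBall z (‖z‖ / 2)) ?_ subset_rfl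
      exact fun x hx => (hR (hball z hz x hx)).1.differentiableWithinAt
    · simpa using (hR (hball z hz x (Metric.sphere_subset_closedBall hx))).2
  exact squeeze_zero_norm' hcauchy <| Tendsto.const_div_atTop
    (tendsto_norm_cobounded_atTop.atTop_div_const two_pos) C

theorem tendsto_zero_of_tendsto_mul_cobounded {K : Type*} [NormedField K] {f : K → K} {r : K}
    (hf : Tendsto (fun z => z * f z) (cobounded K) (𝓝 r)) : Tendsto f (cobounded K) (𝓝 0) := by
  have hlim := tendsto_inv₀_cobounded.mul hf
  rw [zero_mul] at hlim
  refine hlim.congr' ?_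
  filter_upwards [eventually_ne_cobounded 0] with z hz
  exact inv_mul_cancel_left₀ hz _

theorem eventually_cobounded_eval_ne_zero {R : Type*} [CommRing R] [IsDomain R] [Bornology R]
    {A : R[X]} (hA : A ≠ 0) : ∀ᶠ z in cobounded R, A.eval z ≠ 0 :=
  (eventually_cofinite_not_isRoot hA).filter_mono (le_cofinite R)

theorem degree_X_mul_derivative_sub_lt {R : Type*} [CommRing R] {A : R[X]} (hA : A ≠ 0) :
    (X * derivative A - C (A.natDegree : R) * A).degree < A.degree := by
  have hcoeff (k : ℕ) : (X * derivative A).coeff k = k * A.coeff k := by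
    cases k <;> simp [coeff_derivative, mul_comm]
  rw [degree_eq_natDegree hA, degree_lt_iff_coeff_zero]
  intro k hk
  rw [coeff_sub, hcoeff, coeff_C_mul]
  rcases hk.eq_or_lt with rfl | hk
  · exact sub_self _
  · rw [coeff_eq_zero_of_natDegree_lt hk, mul_zero, mul_zero, sub_zero]

variable {K : Type*} [NontriviallyNormedField K] {A B : K[X]}

theorem tendsto_mul_logDeriv_eval (hA : A ≠ 0) :
    Tendsto (fun z => z * logDeriv A.eval z) (cobounded K) (𝓝 A.natDegree) := by
  have hlim := (isLittleO_cobounded_of_degree_lt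
    (degree_X_mul_derivative_sub_lt hA)).tendsto_div_nhds_zero.add_const (A.natDegree : K)
  rw [zero_add] at hlim
  refine hlim.congr' ?_
  filter_upwards [eventually_cobounded_eval_ne_zero hA] with z hz
  rw [logDeriv_apply, Polynomial.deriv, eval_sub, eval_mul, eval_mul, eval_X, eval_C]
  field_simp
  ring

theorem tendsto_mul_logDeriv_eval_div (hA : A ≠ 0) (hB : B ≠ 0) :
    Tendsto (fun z => z * logDeriv (fun x => A.eval x / B.eval x) z) (cobounded K)
      (𝓝 (A.natDegree - B.natDegree)) := by
  refine ((tendsto_mul_logDeriv_eval hA).sub (tendsto_mul_logDeriv_eval hB)).congr' ?_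
  filter_upwards [eventually_cobounded_eval_ne_zero hA, eventually_cobounded_eval_ne_zero hB]
    with z hAz hBz
  rw [logDeriv_div z hAz hBz A.differentiableAt B.differentiableAt, mul_sub]

end Cobounded

open Bornology Filter in
/-- The algebra of functions that are holomorphic at `∞`, i.e. analytic and bounded near `∞`. Being
defined by a condition near `∞`, it ignores the junk values of a rational function at its poles. -/
def holomorphicAtInfty : Subalgebra ℂ (ℂ → ℂ) where
  carrier := {f | (∀ᶠ z in cobounded ℂ, AnalyticAt ℂ f z) ∧ f =O[cobounded ℂ] (1 : ℂ → ℂ)}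
  mul_mem' hf hg := ⟨(hf.1.and hg.1).mono fun _ h => h.1.mul h.2,
    (hf.2.mul hg.2).congr_right fun _ => one_mul 1⟩
  add_mem' hf hg := ⟨(hf.1.and hg.1).mono fun _ h => h.1.add h.2, hf.2.add hg.2⟩
  algebraMap_mem' c :=
    ⟨.of_forall fun _ => analyticAt_const, Asymptotics.isBigO_const_const c one_ne_zero _⟩

/-- The value at `z` of the differential polynomial `P[u]`, where `X k` stands for the `k`-th
derivative of `u`. -/
noncomputable def diffPolyEval {R : Type*} [CommSemiring R] [Algebra R ℂ] (P : MvPolynomial ℕ R)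
    (u : ℂ → ℂ) (z : ℂ) : ℂ :=
  MvPolynomial.aeval (fun k => iteratedDeriv k u z) P

namespace holomorphicAtInfty

open Bornology Filter Polynomial Topology

variable {f : ℂ → ℂ}

theorem tendsto_deriv (hf : f ∈ holomorphicAtInfty) : Tendsto (deriv f) (cobounded ℂ) (𝓝 0) :=
  tendsto_deriv_cobounded (hf.1.mono fun _ h => h.differentiableAt) hf.2

theorem deriv_mem (hf : f ∈ holomorphicAtInfty) : deriv f ∈ holomorphicAtInfty :=
  ⟨hf.1.mono fun _ h => h.deriv, (tendsto_deriv hf).isBigO_one ℂ⟩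

theorem iteratedDeriv_mem (hf : f ∈ holomorphicAtInfty) (k : ℕ) :
    iteratedDeriv k f ∈ holomorphicAtInfty := by
  induction k with
  | zero => rwa [iteratedDeriv_zero]
  | succ k ih => exact iteratedDeriv_succ (f := f) ▸ deriv_mem ih

theorem diffPolyEval_mem {R : Type*} [CommSemiring R] [Algebra R ℂ] (P : MvPolynomial ℕ R)
    (hf : f ∈ holomorphicAtInfty) : diffPolyEval P f ∈ holomorphicAtInfty := by
  induction P using MvPolynomial.induction_on with
  | C a =>
    have hC : diffPolyEval (MvPolynomial.C a) f = algebraMap ℂ (ℂ → ℂ) (algebraMap R ℂ a) := by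
      ext z
      exact MvPolynomial.aeval_C _ a
    exact hC ▸ algebraMap_mem holomorphicAtInfty _
  | add p q hp hq =>
    have hadd : diffPolyEval (p + q) f = diffPolyEval p f + diffPolyEval q f := by
      ext z
      exact map_add _ p q
    exact hadd ▸ add_mem hp hq
  | mul_X p k hp =>
    have hmul : diffPolyEval (p * MvPolynomial.X k) f = diffPolyEval p f * iteratedDeriv k f := by
      ext z
      simp only [diffPolyEval, map_mul, MvPolynomial.aeval_X, Pi.mul_apply]
    exact hmul ▸ mul_mem hp (iteratedDeriv_mem hf k)

theorem logDeriv_eval_div_mem {A B : ℂ[X]} (hA : A ≠ 0) (hB : B ≠ 0) :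
    logDeriv (fun x => A.eval x / B.eval x) ∈ holomorphicAtInfty := by
  have hlim := tendsto_zero_of_tendsto_mul_cobounded (tendsto_mul_logDeriv_eval_div hA hB)
  refine ⟨?_, hlim.isBigO_one ℂ⟩
  filter_upwards [eventually_cobounded_eval_ne_zero hA, eventually_cobounded_eval_ne_zero hB]
    with z hAz hBz
  have hquot : AnalyticAt ℂ (fun x => A.eval x / B.eval x) z :=
    (AnalyticOnNhd.eval_polynomial A z trivial).div (AnalyticOnNhd.eval_polynomial B z trivial) hBz
  exact hquot.deriv.div hquot (div_ne_zero hAz hBz)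

end holomorphicAtInfty

/-- The left-hand side at `z` of the equation `(d/dz + 2w) P[w' - w²] - z w - α = 0`: the `N`-th
equation of the second Painlevé hierarchy with an arbitrary differential polynomial `P` in place of
the Lenard polynomial `L_N`. -/
noncomputable def generalizedPainleveII {R : Type*} [CommSemiring R] [Algebra R ℂ]
    (P : MvPolynomial ℕ R) (α : ℂ) (w : ℂ → ℂ) (z : ℂ) : ℂ :=
  deriv (diffPolyEval P fun x => deriv w x - w x ^ 2) z
    + 2 * w z * diffPolyEval P (fun x => deriv w x - w x ^ 2) z - z * w z - α

section Degree

open Bornology Filter Polynomial Topology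

variable {R : Type*} [CommSemiring R] [Algebra R ℂ]

theorem tendsto_generalizedPainleveII (P : MvPolynomial ℕ R) (α : ℂ) {w : ℂ → ℂ} {r : ℂ}
    (hw : w ∈ holomorphicAtInfty) (hr : Tendsto (fun z => z * w z) (cobounded ℂ) (𝓝 r)) :
    Tendsto (generalizedPainleveII P α w) (cobounded ℂ) (𝓝 (-r - α)) := by
  have hL : (diffPolyEval P fun x => deriv w x - w x ^ 2) ∈ holomorphicAtInfty :=
    holomorphicAtInfty.diffPolyEval_mem P
      (sub_mem (holomorphicAtInfty.deriv_mem hw) (pow_mem hw 2))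
  have hw₂ : Tendsto (fun z => 2 * w z) (cobounded ℂ) (𝓝 0) := by
    simpa using (tendsto_zero_of_tendsto_mul_cobounded hr).const_mul 2
  have hwL := hw₂.zero_mul_isBoundedUnder_le ((Asymptotics.isBigO_one_iff ℂ).mp hL.2)
  have hlim := (((holomorphicAtInfty.tendsto_deriv hL).add hwL).sub hr).sub_const α
  rwa [add_zero, zero_sub] at hlim

theorem natDegree_sub_natDegree_of_generalizedPainleveII_eq_zero (P : MvPolynomial ℕ R) {α : ℂ}
    {A B : ℂ[X]} (hA : A ≠ 0) (hB : B ≠ 0)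
    (h : ∀ᶠ z in cobounded ℂ,
      generalizedPainleveII P α (logDeriv fun x => A.eval x / B.eval x) z = 0) :
    (B.natDegree : ℂ) - A.natDegree = α := by
  have hlim := tendsto_generalizedPainleveII P α (holomorphicAtInfty.logDeriv_eval_div_mem hA hB)
    (tendsto_mul_logDeriv_eval_div hA hB)
  linear_combination tendsto_nhds_unique (hlim.congr' h) tendsto_const_nhds

theorem IsRationalSolution.eventually_painleveII_eq_zero {N : ℕ} {α : ℂ} {w : ℂ → ℂ}
    (h : IsRationalSolution N α w) : ∀ᶠ z in cobounded ℂ, painleveII N α w z = 0 := by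
  obtain ⟨_, q, hq, hsol⟩ := h
  exact (eventually_cobounded_eval_ne_zero hq).mono fun z hz => (hsol z hz).2

theorem mainTheorem2_general (P : MvPolynomial ℕ R) {Q : ℕ → ℂ[X]} (hQ₀ : (Q 0).natDegree = 0)
    (hQ : ∀ n, Q n ≠ 0)
    (hsol : ∀ n : ℕ, ∀ᶠ z in cobounded ℂ, generalizedPainleveII P (n + 1 : ℕ)
      (logDeriv fun x => (Q n).eval x / (Q (n + 1)).eval x) z = 0) (n : ℕ) :
    (Q n).natDegree = ∑ i ∈ Finset.Icc 1 n, i ∧ (Q n).natDegree = n * (n + 1) / 2 := by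
  have hstep (n : ℕ) : (Q (n + 1)).natDegree = (Q n).natDegree + (n + 1) := by
    have h := natDegree_sub_natDegree_of_generalizedPainleveII_eq_zero P (hQ n) (hQ (n + 1))
      (hsol n)
    exact_mod_cast sub_eq_iff_eq_add'.mp h
  have hsum : (Q n).natDegree = ∑ i ∈ Finset.range (n + 1), i := by
    induction n with
    | zero => simpa using hQ₀
    | succ n ih => rw [hstep, ih, ← Finset.sum_range_succ]
  refine ⟨?_, by rw [hsum, Finset.sum_range_id, Nat.add_sub_cancel, mul_comm]⟩
  rw [hsum, Finset.range_eq_Ico, Finset.sum_eq_sum_Ico_succ_bot n.succ_pos, zero_add]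
  rfl

end Degree

open Polynomial in
theorem mainTheorem2 (N : ℕ) (hN : 1 ≤ N) (Q : ℕ → ℂ[X])
    (hQ : IsYablonskiiVorobevFamily N Q) (n : ℕ) :
    (Q n).natDegree = ∑ i ∈ Finset.Icc 1 n, i ∧ (Q n).natDegree = n * (n + 1) / 2 :=
  mainTheorem2_general (lenard N) (by rw [hQ.zero, natDegree_one]) (fun n => (hQ.monic n).ne_zero)
    (fun n => (hQ.solution (n + 1) n.succ_pos).eventually_painleveII_eq_zero) n
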